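/- Let $d\ge 2$ be an integer and let $K$ be a real number. There is a constant $N\ge 0$, depending only on $K$ and $d$, such that the following holds for every integer $m$ with $2\le m\le d$. For a real symmetric $d\times d$ matrix $w$ let $P_m(w)$ be the $m$th elementary symmetric polynomial of the eigenvalues of $w$, and let $C_m$ be the connected component, containing the identity matrix, of the set of symmetric matrices $w$ with $P_m(w)>0$. For a matrix $a$ let $|a|=(\sum_{i,j}a_{ij}^2)^{1/2}$. Let $D\subset\mathbb R^d$ be a bounded domain (a nonempty connected open set) with $\operatorname{diam} D\le K$, and let $g\in C^2(\bar D)$ satisfy $g>0$ in $D$, $|\nabla g|^2\le Kg$ in $D$, and be such that $g(x)+K|x|^2$ is convex on $\bar D$ (that is, convex along each segment contained in $\bar D$). Let $u\in C^4(D)\cap C^2(\bar D)$ satisfy $$P_m(u_{xx})=g^{m-1}\quad\text{and}\quad u_{xx}\in C_m\qquad\text{in } D,$$ where $u_{xx}=D^2u$ is the Hessian matrix of $u$ (so $u$ is in particular $m$-admissible, i.e. $u_{xx}\in\bar C_m$). Then $$\sup_D|D^2u|\le N\Bigl(1+\sup_{\partial D}|D^2u|\Bigr),$$ where on $\partial D$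 the matrix $D^2u$ is the continuous extension of the Hessian from $D$. ($C^2(\bar D)$ is the set of functions on $\bar D$ that are $C^2$ in $D$ and that, together with their derivatives of order at most 2, are continuous up to $\bar D$.) -/

import Mathlib

open scoped Topology NNReal ENNReal

noncomputable section

namespace HessianEq

/-- `P m w` is the `m`-th elementary symmetric polynomial of the eigenvalues of `w`, counted with
multiplicity (for a real symmetric matrix all the `d` eigenvalues are real roots of the
characteristic polynomial). -/
def P {d : ℕ} (m : ℕ) (w : Matrix (Fin d) (Fin d) ℝ) : ℝ :=
  w.charpoly.roots.esymm m

/-- `C_m`: the connected component, containing the identity matrix, of the set of all symmetric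
matrices `w` such that `P_m(w) > 0`. -/
def Cone (d m : ℕ) : Set (Matrix (Fin d) (Fin d) ℝ) :=
  connectedComponentIn {w : Matrix (Fin d) (Fin d) ℝ | w.IsSymm ∧ 0 < P m w} 1

/-- The Hessian matrix `(u_{x^i x^j}(x))`, in the standard orthonormal basis. -/
def hess {d : ℕ} (u : EuclideanSpace ℝ (Fin d) → ℝ) (x : EuclideanSpace ℝ (Fin d)) :
    Matrix (Fin d) (Fin d) ℝ :=
  Matrix.of fun i j =>
    iteratedFDeriv ℝ 2 u x ![EuclideanSpace.single i (1 : ℝ), EuclideanSpace.single j (1 : ℝ)]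

/-- The extension by continuity of the Hessian matrix from `D` to the closure of `D`. Its boundary
values are the limits of `hess u y` as `y` tends to the boundary point inside `D`. -/
def hessExt {d : ℕ} (D : Set (EuclideanSpace ℝ (Fin d))) (u : EuclideanSpace ℝ (Fin d) → ℝ) :
    EuclideanSpace ℝ (Fin d) → Matrix (Fin d) (Fin d) ℝ :=
  extendFrom D (hess u)

/-- The Euclidean norm `(∑ a_{ij}²)^{1/2}` of a matrix. -/
def matNorm {d : ℕ} (a : Matrix (Fin d) (Fin d) ℝ) : ℝ :=
  Real.sqrt (∑ i, ∑ j, a i j ^ 2)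

/-- `u ∈ C^n(D̄)` for an open set `D`: `u` is of class `C^n` in `D`, it is continuous on the
closure of `D`, and every derivative of `u` of order at most `n` extends continuously from `D` to
the closure of `D`. -/
def ContDiffClosure {d : ℕ} (n : ℕ) (u : EuclideanSpace ℝ (Fin d) → ℝ)
    (D : Set (EuclideanSpace ℝ (Fin d))) : Prop :=
  ContDiffOn ℝ n u D ∧ ContinuousOn u (closure D) ∧
    ∀ k ≤ n, ∃ v : EuclideanSpace ℝ (Fin d) →
        ContinuousMultilinearMap ℝ (fun _ : Fin k => EuclideanSpace ℝ (Fin d)) ℝ,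
      ContinuousOn v (closure D) ∧ Set.EqOn v (iteratedFDeriv ℝ k u) D

/-- Convexity on a set that need not be convex: convexity along every segment in the set. -/
def ConvexAlongSegments {d : ℕ} (S : Set (EuclideanSpace ℝ (Fin d)))
    (f : EuclideanSpace ℝ (Fin d) → ℝ) : Prop :=
  ∀ x y : EuclideanSpace ℝ (Fin d), segment ℝ x y ⊆ S → ConvexOn ℝ (segment ℝ x y) f

end HessianEq

end

/-! A Bernstein-type argument applied to the Laplacian of `u`. Let `z` maximize `Δu + A|x - x₀|²`
over the closure of `D`. In the cone `e₁ > 0` and `e₂ ≥ 0`, so `|λ|² = e₁² - 2e₂ ≤ e₁²`: the trace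
controls the whole Hessian. If `z` is a boundary point, the boundary supremum gives the bound. If
`z` is interior, `Δu(z) < 1` (`trace_hess_lt_one`).

For the interior case, write the equation as `log P_m(u_xx) = (m-1) log g`. Let `b_i` be an
eigenbasis of `u_xx(z)` and `l_i` the derivatives of `log e_m` at its eigenvalues. Concavity of `log
P_m` (`log_P_le`) says that `∑ l_i u_{b_i b_i} - (m-1) log g`, with `l_i` and `b_i` frozen, has a
minimum over `D` at `z`. This replaces differentiating the equation twice. Its second derivatives
along each `b_k`, summed over `k`, give `∑ l_i D_i²Δu ≥ (m-1) ∑ D_k² log g ≥ -3d(m-1)K/g`, by the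
hypotheses on `g`. Maximality of `z` gives `∑ l_i D_i²Δu ≤ -2A ∑ l_i`.

If `Δu(z) ≥ 1`, the interpolation inequality `e_{m-1}^{m-1} ≥ e_m^{m-2} e₁` and `e_m = g^{m-1}`
yield `∑ l_i ≥ 1/g` (`one_div_le_sum`). The factors `1/g` cancel, however small `g` is, and a large
`A` gives a contradiction.

The algebra rests on Newton's inequalities, which identify `C_m` with a part of the Gårding cone,
and on the Marcus–Lopes superadditivity of `e_{k+1}/e_k`, which gives concavity. -/

namespace HessianEq

open Finset Polynomial

/-! ### Elementary symmetric polynomials and their derivatives -/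

section Esym

variable {ι : Type*}

/-- The `k`-th elementary symmetric polynomial of the real numbers `x i`, `i ∈ s`. -/
def esym (s : Finset ι) (k : ℕ) (x : ι → ℝ) : ℝ :=
  ∑ t ∈ s.powersetCard k, ∏ i ∈ t, x i

@[simp] lemma esym_zero (s : Finset ι) (x : ι → ℝ) : esym s 0 x = 1 := by simp [esym]

lemma esym_eq_multiset (s : Finset ι) (k : ℕ) (x : ι → ℝ) :
    esym s k x = (s.val.map x).esymm k := (Finset.esymm_map_val x s k).symm

lemma esym_one (s : Finset ι) (x : ι → ℝ) : esym s 1 x = ∑ i ∈ s, x i := by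
  simp [esym, powersetCard_one]

lemma esym_eq_zero_of_card_lt {s : Finset ι} {k : ℕ} (h : #s < k) (x : ι → ℝ) :
    esym s k x = 0 := by
  simp [esym, powersetCard_eq_empty.2 h]

lemma esym_comp_perm [Fintype ι] (σ : Equiv.Perm ι) (k : ℕ) (x : ι → ℝ) :
    esym univ k (x ∘ σ) = esym univ k x := by
  rw [esym_eq_multiset, esym_eq_multiset, ← Multiset.map_map]
  congr 2
  simp

lemma esym_smul (s : Finset ι) (k : ℕ) (c : ℝ) (x : ι → ℝ) :
    esym s k (fun i => c * x i) = c ^ k * esym s k x := by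
  rw [esym, esym, mul_sum]
  refine sum_congr rfl fun t ht => ?_
  rw [prod_mul_distrib, prod_const, (mem_powersetCard.1 ht).2]

variable [DecidableEq ι]

lemma esym_insert {s : Finset ι} {a : ι} (h : a ∉ s) (k : ℕ) (x : ι → ℝ) :
    esym (insert a s) (k + 1) x = esym s (k + 1) x + x a * esym s k x := by
  rw [esym, powersetCard_succ_insert h, sum_union, sum_image, esym, esym, mul_sum]
  · congr 1
    refine sum_congr rfl fun t ht => ?_
    rw [prod_insert]
    exact fun hat => h ((mem_powersetCard.1 ht).1 hat)
  · intro t ht t' ht' e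
    have h1 : a ∉ t := fun hat => h ((mem_powersetCard.1 ht).1 hat)
    have h2 : a ∉ t' := fun hat => h ((mem_powersetCard.1 ht').1 hat)
    rw [← erase_insert h1, ← erase_insert h2, e]
  · rw [disjoint_left]
    intro t ht ht'
    obtain ⟨t', -, rfl⟩ := mem_image.1 ht'
    exact h ((mem_powersetCard.1 ht).1 (mem_insert_self _ _))

lemma esym_erase {s : Finset ι} {a : ι} (h : a ∈ s) (k : ℕ) (x : ι → ℝ) :
    esym s (k + 1) x = esym (s.erase a) (k + 1) x + x a * esym (s.erase a) k x := by
  conv_lhs => rw [← insert_erase h]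
  exact esym_insert (notMem_erase a s) k x

lemma hasDerivAt_esym (s : Finset ι) (k : ℕ) (x y : ι → ℝ) (t : ℝ) :
    HasDerivAt (fun t : ℝ => esym s (k + 1) (fun i => x i + t * y i))
      (∑ i ∈ s, y i * esym (s.erase i) k (fun i => x i + t * y i)) t := by
  induction s using Finset.induction_on generalizing k with
  | empty =>
    simp only [esym_eq_zero_of_card_lt (s := (∅ : Finset ι)) (k := k + 1) (by simp)]
    simpa using hasDerivAt_const t (0 : ℝ)
  | insert a s ha ih =>
    have hl : HasDerivAt (fun t : ℝ => x a + t * y a) (y a) t := by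
      simpa using ((hasDerivAt_id t).mul_const (y a)).const_add (x a)
    have hne : ∀ i ∈ s, (insert a s).erase i = insert a (s.erase i) := fun i hi =>
      erase_insert_of_ne (fun e => ha (e ▸ hi))
    have hna : ∀ i, a ∉ s.erase i := fun i h => ha (mem_of_mem_erase h)
    simp only [esym_insert ha]
    rw [sum_insert ha, erase_insert ha]
    cases k with
    | zero =>
      simp only [esym_zero, mul_one] at ih ⊢
      exact ((ih 0).add hl).congr_deriv (by simp [add_comm])
    | succ k =>
      refine ((ih (k + 1)).add (hl.mul (ih k))).congr_deriv ?_
      rw [add_left_comm]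
      congr 1
      rw [mul_sum, ← sum_add_distrib]
      refine sum_congr rfl fun i hi => ?_
      rw [hne i hi, esym_insert (hna i)]
      ring

/-- Euler's identity. -/
lemma sum_mul_esym_erase (s : Finset ι) (k : ℕ) (x : ι → ℝ) :
    ∑ i ∈ s, x i * esym (s.erase i) k x = (k + 1) * esym s (k + 1) x := by
  have h1 := hasDerivAt_esym s k x x 0
  have h2 : HasDerivAt (fun t : ℝ => (1 + t) ^ (k + 1) * esym s (k + 1) x)
      ((k + 1) * esym s (k + 1) x) 0 := by
    have := (((hasDerivAt_id (0 : ℝ)).const_add 1).pow (k + 1)).mul_const (esym s (k + 1) x)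
    simpa using this
  have e : (fun t : ℝ => esym s (k + 1) (fun i => x i + t * x i)) =
      fun t : ℝ => (1 + t) ^ (k + 1) * esym s (k + 1) x := by
    funext t
    rw [← esym_smul]
    congr 1
    funext i
    ring
  rw [e] at h1
  simpa using h1.unique h2

lemma sum_esym_erase (s : Finset ι) (k : ℕ) (x : ι → ℝ) :
    ∑ i ∈ s, esym (s.erase i) k x = (#s - k) * esym s k x := by
  cases k with
  | zero => simp
  | succ k =>
    have h : ∑ i ∈ s, esym s (k + 1) x =
        ∑ i ∈ s, (esym (s.erase i) (k + 1) x + x i * esym (s.erase i) k x) :=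
      sum_congr rfl fun i hi => esym_erase hi k x
    rw [sum_add_distrib, sum_mul_esym_erase, sum_const, nsmul_eq_mul] at h
    push_cast
    linarith

end Esym

/-! ### Newton's inequalities from real-rootedness -/

section Newton

/-- Rolle: differentiation loses at most one real root, counted with multiplicity, and the degree
drops by at least one. -/
lemma splits_derivative {p : ℝ[X]} (hp : p.Splits) : (derivative p).Splits := by
  rw [splits_iff_card_roots] at hp ⊢
  have h1 := card_roots_le_derivative p
  have h2 := (derivative p).card_roots'
  have h3 := natDegree_derivative_lt (p := p)
  by_cases h : p.natDegree = 0
  · have : derivative p = 0 := derivative_of_natDegree_zero h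
    simp [this]
  · have := h3 h
    omega

lemma splits_iterate_derivative {p : ℝ[X]} (hp : p.Splits) (k : ℕ) :
    (derivative^[k] p).Splits := by
  induction k with
  | zero => exact hp
  | succ k ih => rw [Function.iterate_succ_apply']; exact splits_derivative ih

/-- The quantity is `f'(0)² - f(0) f''(0)`, which for nonzero roots equals `f(0)² ∑ 1/r²`. The
induction on roots avoids the division. -/
lemma coeff_sq_of_prod (M : Multiset ℝ) :
    let f := (M.map fun r => X - C r).prod
    0 ≤ f.coeff 1 ^ 2 - 2 * f.coeff 0 * f.coeff 2 ∧
      (f.coeff 0 ≠ 0 → M ≠ 0 → 0 < f.coeff 1 ^ 2 - 2 * f.coeff 0 * f.coeff 2) := by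
  induction M using Multiset.induction_on with
  | empty => simp [coeff_one]
  | cons r M ih =>
    intro f
    set g := (M.map fun r => X - C r).prod with hg
    have hf : f = (X - C r) * g := by simp [f, hg]
    have h0 : f.coeff 0 = - r * g.coeff 0 := by simp [hf, sub_mul]
    have h1 : f.coeff 1 = g.coeff 0 - r * g.coeff 1 := by simp [hf, sub_mul, coeff_X_mul]
    have h2 : f.coeff 2 = g.coeff 1 - r * g.coeff 2 := by simp [hf, sub_mul, coeff_X_mul]
    have e : f.coeff 1 ^ 2 - 2 * f.coeff 0 * f.coeff 2 =
        g.coeff 0 ^ 2 + r ^ 2 * (g.coeff 1 ^ 2 - 2 * g.coeff 0 * g.coeff 2) := by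
      rw [h0, h1, h2]; ring
    have := ih.1
    rw [e]
    refine ⟨by positivity, fun h _ => ?_⟩
    have : g.coeff 0 ≠ 0 := fun h' => h (by rw [h0, h', mul_zero])
    positivity

lemma coeff_sq_of_splits {p : ℝ[X]} (hp : p.Splits) (h0 : p.coeff 0 ≠ 0) (hd : p.natDegree ≠ 0) :
    2 * p.coeff 0 * p.coeff 2 < p.coeff 1 ^ 2 := by
  have e := hp.eq_prod_roots
  have h := (coeff_sq_of_prod p.roots).2
  set q := (p.roots.map fun r => X - C r).prod
  have hk : ∀ k, p.coeff k = p.leadingCoeff * q.coeff k := fun k => by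
    conv_lhs => rw [e]
    rw [coeff_C_mul]
  have hl : p.leadingCoeff ≠ 0 := fun h => h0 (by rw [hk, h, zero_mul])
  have := h (fun h => h0 (by rw [hk, h, mul_zero])) (fun h => hd (by
    rw [hp.natDegree_eq_card_roots, h, Multiset.card_zero]))
  rw [hk, hk, hk]
  have h2 : 0 < p.leadingCoeff ^ 2 := by positivity
  nlinarith

variable {ι : Type*}

/-- Newton's inequality, in the weak form without binomial coefficients, but strict. -/
lemma newton_lt (s : Finset ι) (x : ι → ℝ) (j : ℕ) (h : esym s (j + 2) x ≠ 0) :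
    esym s j x * esym s (j + 2) x < esym s (j + 1) x ^ 2 := by
  have hj : j + 2 ≤ #s := by
    by_contra! hc
    exact h (esym_eq_zero_of_card_lt hc x)
  obtain ⟨n, hn⟩ := Nat.exists_eq_add_of_le hj
  -- The coefficient of degree `k` is `e_{#s-k}`. With `n = #s - j - 2`, the `n`-th derivative is
  -- still real-rooted and carries `e_{j+2}`, `e_{j+1}`, `e_j` in degrees 0, 1, 2, up to factorials.
  set p : ℝ[X] := ∏ i ∈ s, (X + C (x i)) with hp
  have hps : p.Splits := Splits.prod fun i _ => Splits.X_add_C _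
  have hpd : p.natDegree = #s := by
    rw [hp, natDegree_prod_of_monic _ _ fun i _ => monic_X_add_C _]
    simp
  have hc : ∀ k ≤ #s, p.coeff k = esym s (#s - k) x := fun k hk => s.prod_X_add_C_coeff x hk
  have hqc : ∀ k, (derivative^[n] p).coeff k = (k + n).descFactorial n * p.coeff (k + n) :=
    fun k => by rw [coeff_iterate_derivative, nsmul_eq_mul]
  have q0 := hqc 0
  have q1 := hqc 1
  have q2 := hqc 2
  rw [hc _ (by omega), show #s - (0 + n) = j + 2 by omega] at q0
  rw [hc _ (by omega), show #s - (1 + n) = j + 1 by omega] at q1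
  rw [hc _ (by omega), show #s - (2 + n) = j by omega] at q2
  have f0 : ((0 + n).descFactorial n : ℝ) = n.factorial := by simp [Nat.descFactorial_self]
  have f1 : ((1 + n).descFactorial n : ℝ) = (n + 1) * n.factorial := by
    have := Nat.factorial_mul_descFactorial (show n ≤ 1 + n by omega)
    rw [show 1 + n - n = 1 by omega, Nat.factorial_one, one_mul, add_comm, Nat.factorial_succ] at this
    rw [add_comm 1 n, this]; push_cast; ring
  have f2 : 2 * ((2 + n).descFactorial n : ℝ) = (n + 2) * (n + 1) * n.factorial := by
    have := Nat.factorial_mul_descFactorial (show n ≤ 2 + n by omega)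
    rw [show 2 + n - n = 2 by omega, Nat.factorial_two, add_comm, Nat.factorial_succ,
      Nat.factorial_succ] at this
    rw [add_comm 2 n]
    have h' : ((2 * (n + 2).descFactorial n : ℕ) : ℝ) = _ := congrArg Nat.cast this
    push_cast at h'
    rw [h']; ring
  have hF : (0 : ℝ) < n.factorial := by exact_mod_cast n.factorial_pos
  have hq0 : (derivative^[n] p).coeff 0 ≠ 0 := by
    rw [q0, f0]; positivity
  -- The factorials leave a constant `(n+2)/(n+1) > 1` in favour of the claim, which is discarded at
  -- the end.
  have hmain : (n + 2) * (esym s j x * esym s (j + 2) x) < (n + 1) * esym s (j + 1) x ^ 2 := by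
    have hdeg : (derivative^[n] p).natDegree ≠ 0 := by
      intro h0
      have hz : (derivative^[n] p).coeff (j + 2) = 0 :=
        coeff_eq_zero_of_natDegree_lt (by omega)
      rw [hqc, hc _ (by omega), show #s - (j + 2 + n) = 0 by omega, esym_zero, mul_one] at hz
      have : 0 < (j + 2 + n).descFactorial n := Nat.descFactorial_pos.2 (by omega)
      exact this.ne' (by exact_mod_cast hz)
    have := coeff_sq_of_splits (splits_iterate_derivative hps n) hq0 hdeg
    rw [q0, q1, q2, f0, f1] at this
    have h3 : (n.factorial : ℝ) ^ 2 * (n + 1) * ((n + 2) * (esym s j x * esym s (j + 2) x)) <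
        (n.factorial : ℝ) ^ 2 * (n + 1) * ((n + 1) * esym s (j + 1) x ^ 2) := by
      calc _ = (n.factorial : ℝ) * ((n + 2) * (n + 1) * n.factorial) *
            (esym s j x * esym s (j + 2) x) := by ring
        _ = (n.factorial : ℝ) * (2 * ((2 + n).descFactorial n : ℝ)) *
            (esym s j x * esym s (j + 2) x) := by rw [f2]
        _ < ((n + 1) * n.factorial * esym s (j + 1) x) ^ 2 := by linarith
        _ = _ := by ring
    exact lt_of_mul_lt_mul_left h3 (by positivity)
  have hn0 : (0 : ℝ) ≤ n := Nat.cast_nonneg n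
  by_contra! hle
  have := sq_nonneg (esym s (j + 1) x)
  nlinarith

lemma newton_le (s : Finset ι) (x : ι → ℝ) (j : ℕ) :
    esym s j x * esym s (j + 2) x ≤ esym s (j + 1) x ^ 2 := by
  by_cases h : esym s (j + 2) x = 0
  · rw [h, mul_zero]; positivity
  · exact (newton_lt s x j h).le

end Newton

/-! ### The Gårding cone and concavity of `log e_m` -/

section Garding

variable {ι : Type*}

/-- The Gårding cone `{e_1 > 0, …, e_k > 0}`. -/
def IsGarding (s : Finset ι) (k : ℕ) (x : ι → ℝ) : Prop :=
  ∀ j ≤ k, 0 < esym s j x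

lemma IsGarding.mono {s : Finset ι} {k l : ℕ} {x : ι → ℝ} (h : IsGarding s k x) (hl : l ≤ k) :
    IsGarding s l x := fun j hj => h j (hj.trans hl)

lemma IsGarding.succ {s : Finset ι} {k : ℕ} {x : ι → ℝ} (h : IsGarding s k x)
    (hk : 0 < esym s (k + 1) x) : IsGarding s (k + 1) x := fun j hj => by
  rcases Nat.le_succ_iff.1 hj with h' | rfl
  exacts [h j h', hk]

lemma IsGarding.smul {s : Finset ι} {k : ℕ} {x : ι → ℝ} (h : IsGarding s k x) {c : ℝ}
    (hc : 0 < c) : IsGarding s k (fun i => c * x i) := fun j hj => by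
  rw [esym_smul]
  exact mul_pos (pow_pos hc _) (h j hj)

/-- On the closed cone, `e_k > 0` forces all the lower symmetric polynomials to be positive. -/
lemma IsGarding.of_nonneg {s : Finset ι} {k : ℕ} {x : ι → ℝ} (h : ∀ j ≤ k, 0 ≤ esym s j x)
    (hk : 0 < esym s k x) : IsGarding s k x := by
  induction k with
  | zero => intro j hj; simp [Nat.le_zero.1 hj]
  | succ k ih =>
    refine IsGarding.succ (ih (fun j hj => h j (by omega)) ?_) hk
    cases k with
    | zero => simp
    | succ k =>
      -- Strictness matters: it excludes `e_{k+1} = 0` on the boundary of the cone.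
      have h1 := newton_lt s x k hk.ne'
      have h2 := mul_nonneg (h k (by omega)) hk.le
      have h3 : esym s (k + 1) x ≠ 0 := fun h0 => by rw [h0] at h1; linarith
      exact lt_of_le_of_ne (h (k + 1) (by omega)) h3.symm

lemma IsGarding.erase [DecidableEq ι] {s : Finset ι} {k : ℕ} {x : ι → ℝ}
    (h : IsGarding s (k + 1) x) {i : ι} (hi : i ∈ s) : IsGarding (s.erase i) k x := by
  intro j
  induction j with
  | zero => simp
  | succ j ih =>
    intro hj
    have hb := ih (by omega)
    by_contra! hc
    have h1 := h (j + 1) (by omega)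
    have h2 := h (j + 2) (by omega)
    rw [esym_erase hi] at h1 h2
    have hN := newton_le (s.erase i) x j
    set b0 := esym (s.erase i) j x
    set b1 := esym (s.erase i) (j + 1) x
    set b2 := esym (s.erase i) (j + 2) x
    -- Adding `h3` and `h4` cancels the terms in `x i` and leaves `b0 * b2 > b1 ^ 2`, against
    -- Newton.
    have h3 : b0 * (b2 + x i * b1) > 0 := mul_pos hb h2
    have h4 : 0 ≤ (b1 + x i * b0) * (-b1) := mul_nonneg h1.le (by linarith)
    nlinarith

/-- The quotient `e_{k+1} / e_k`. -/
noncomputable def esymQuot (s : Finset ι) (k : ℕ) (x : ι → ℝ) : ℝ := esym s (k + 1) x / esym s k x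

lemma IsGarding.esymQuot_pos {s : Finset ι} {k : ℕ} {x : ι → ℝ} (h : IsGarding s (k + 1) x) :
    0 < esymQuot s k x := div_pos (h _ le_rfl) (h _ (by omega))

lemma esymQuot_smul {s : Finset ι} {k : ℕ} {x : ι → ℝ} {c : ℝ} (hc : c ≠ 0) :
    esymQuot s k (fun i => c * x i) = c * esymQuot s k x := by
  rw [esymQuot, esymQuot, esym_smul, esym_smul, pow_succ, mul_assoc, mul_div_mul_left _ _
    (pow_ne_zero _ hc), mul_div_assoc]

lemma IsGarding.prod_esymQuot {s : Finset ι} {k : ℕ} {x : ι → ℝ} (h : IsGarding s k x) :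
    ∏ j ∈ range k, esymQuot s j x = esym s k x := by
  induction k with
  | zero => simp
  | succ k ih =>
    rw [prod_range_succ, ih (h.mono (by omega)), esymQuot,
      mul_div_cancel₀ _ (h k (by omega)).ne']

lemma IsGarding.esymQuot_succ_le {s : Finset ι} {k : ℕ} {x : ι → ℝ} (h : IsGarding s (k + 1) x) :
    esymQuot s (k + 1) x ≤ esymQuot s k x := by
  rw [esymQuot, esymQuot, div_le_div_iff₀ (h _ le_rfl) (h _ (by omega))]
  have := newton_le s x k
  rw [show k + 1 + 1 = k + 2 from rfl]
  nlinarith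

/-- The interpolation inequality `e_{m-1}^{m-1} ≥ e_m^{m-2} e_1`, with `m = k + 2`. -/
lemma IsGarding.esym_pow_mul_le {s : Finset ι} {k : ℕ} {x : ι → ℝ} (h : IsGarding s (k + 2) x) :
    esym s (k + 2) x ^ k * esym s 1 x ≤ esym s (k + 1) x ^ (k + 1) := by
  set r := esymQuot s (k + 1) x with hr
  have hr0 : 0 < r := h.esymQuot_pos
  have hle : ∀ j ≤ k + 1, r ≤ esymQuot s j x := fun j hj => by
    refine Nat.decreasingInduction' (P := fun j => r ≤ esymQuot s j x) (fun i hi _ hP => ?_) hj le_rfl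
    exact hP.trans (h.mono (by omega)).esymQuot_succ_le
  -- Since `r` is the smallest of the quotients up to index `k + 1`, each step from `e_{j+1}` to
  -- `e_{j+2}` gains at least a factor `r`.
  have hE : ∀ j ≤ k, r ^ j * esym s 1 x ≤ esym s (j + 1) x := fun j => by
    induction j with
    | zero => simp
    | succ j ih =>
      intro hj
      have e : esym s (j + 2) x = esymQuot s (j + 1) x * esym s (j + 1) x := by
        rw [esymQuot, div_mul_cancel₀ _ (h (j + 1) (by omega)).ne']
      rw [e, pow_succ', mul_assoc]
      exact mul_le_mul (hle _ (by omega)) (ih (by omega))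
        (mul_nonneg (by positivity) (h 1 (by omega)).le) (hr0.le.trans (hle _ (by omega)))
  have e : esym s (k + 2) x = r * esym s (k + 1) x := by
    rw [hr, esymQuot, div_mul_cancel₀ _ (h (k + 1) (by omega)).ne']
  have hp := h (k + 1) (by omega)
  calc _ = esym s (k + 1) x ^ k * (r ^ k * esym s 1 x) := by rw [e]; ring
    _ ≤ esym s (k + 1) x ^ k * esym s (k + 1) x :=
      mul_le_mul_of_nonneg_left (hE k le_rfl) (by positivity)
    _ = _ := by ring

lemma one_add_sum_le_prod_one_add (s : Finset ι) {f : ι → ℝ} (h : ∀ i ∈ s, 0 ≤ f i) :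
    1 + ∑ i ∈ s, f i ≤ ∏ i ∈ s, (1 + f i) := by
  classical
  induction s using Finset.induction_on with
  | empty => simp
  | insert a s ha ih =>
    rw [sum_insert ha, prod_insert ha]
    have h1 := ih fun i hi => h i (mem_insert_of_mem hi)
    have h2 := h a (mem_insert_self _ _)
    have h3 : 0 ≤ ∑ i ∈ s, f i := sum_nonneg fun i hi => h i (mem_insert_of_mem hi)
    nlinarith [mul_le_mul_of_nonneg_left h1 h2, mul_nonneg h2 h3]

variable [DecidableEq ι]

lemma IsGarding.add_esymQuot_erase {s : Finset ι} {k : ℕ} {x : ι → ℝ}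
    (h : IsGarding s (k + 1) x) {i : ι} (hi : i ∈ s) :
    x i + esymQuot (s.erase i) k x = esym s (k + 1) x / esym (s.erase i) k x := by
  have := h.erase hi k le_rfl
  rw [esym_erase hi, esymQuot]
  field_simp
  ring

/-- Euler's identity rewritten so that the quotient of order `k + 1` depends on lower quotients only
through `x_i² / (x_i + q_i)`. This is the recursion behind the superadditivity proof. -/
lemma IsGarding.mul_esymQuot {s : Finset ι} {k : ℕ} {x : ι → ℝ} (h : IsGarding s (k + 1) x) :
    (k + 2) * esymQuot s (k + 1) x =
      ∑ i ∈ s, (x i - x i ^ 2 / (x i + esymQuot (s.erase i) k x)) := by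
  have hE := sum_mul_esym_erase s (k + 1) x
  have hp := h (k + 1) le_rfl
  rw [esymQuot, ← mul_div_assoc]
  push_cast at hE
  rw [show (k : ℝ) + 1 + 1 = k + 2 by ring] at hE
  rw [← hE, sum_div]
  refine sum_congr rfl fun i hi => ?_
  have := h.erase hi k le_rfl
  rw [h.add_esymQuot_erase hi]
  have e : esym (s.erase i) (k + 1) x = esym s (k + 1) x - x i * esym (s.erase i) k x := by
    rw [esym_erase hi]; ring
  rw [e]
  field_simp

lemma add_sq_div_add_le {a b X Y : ℝ} (hX : 0 < X) (hY : 0 < Y) :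
    (a + b) ^ 2 / (X + Y) ≤ a ^ 2 / X + b ^ 2 / Y := by
  rw [div_add_div _ _ hX.ne' hY.ne', div_le_div_iff₀ (by positivity) (by positivity)]
  nlinarith [sq_nonneg (a * Y - b * X)]

/-- Marcus–Lopes: the quotients of elementary symmetric polynomials are superadditive. -/
lemma IsGarding.add_and_esymQuot_add {s : Finset ι} {k : ℕ} {x y : ι → ℝ} (hx : IsGarding s k x)
    (hy : IsGarding s k y) : IsGarding s k (x + y) ∧
      esymQuot s k x + esymQuot s k y ≤ esymQuot s k (x + y) := by
  induction k generalizing s with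
  | zero =>
    refine ⟨fun j hj => by simp [Nat.le_zero.1 hj], ?_⟩
    simp [esymQuot, esym_one, sum_add_distrib]
  | succ k ih =>
    obtain ⟨h1, h2⟩ := ih (hx.mono (by omega)) (hy.mono (by omega))
    have h3 : IsGarding s (k + 1) (x + y) := by
      refine h1.succ ?_
      have : 0 < esymQuot s k (x + y) :=
        (add_pos hx.esymQuot_pos hy.esymQuot_pos).trans_le h2
      rw [esymQuot] at this
      exact (div_pos_iff_of_pos_right (h1 k le_rfl)).1 this
    refine ⟨h3, ?_⟩
    have hk : (0 : ℝ) < k + 2 := by positivity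
    refine le_of_mul_le_mul_left ?_ hk
    rw [mul_add, hx.mul_esymQuot, hy.mul_esymQuot, h3.mul_esymQuot, ← sum_add_distrib]
    refine sum_le_sum fun i hi => ?_
    have hX : 0 < x i + esymQuot (s.erase i) k x := by
      rw [hx.add_esymQuot_erase hi]
      exact div_pos (hx _ le_rfl) (hx.erase hi k le_rfl)
    have hY : 0 < y i + esymQuot (s.erase i) k y := by
      rw [hy.add_esymQuot_erase hi]
      exact div_pos (hy _ le_rfl) (hy.erase hi k le_rfl)
    have hq := (ih (hx.erase hi) (hy.erase hi)).2
    set X := x i + esymQuot (s.erase i) k x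
    set Y := y i + esymQuot (s.erase i) k y
    -- The map `(a, X) ↦ a²/X` decreases in `X > 0` and is subadditive; the first fact absorbs the
    -- induction hypothesis, the second splits the sum.
    have h4 : (x i + y i) ^ 2 / ((x + y) i + esymQuot (s.erase i) k (x + y)) ≤
        (x i + y i) ^ 2 / (X + Y) :=
      div_le_div_of_nonneg_left (by positivity) (by positivity)
        (by simp only [X, Y, Pi.add_apply]; linarith)
    have h5 : (x i + y i) ^ 2 / (X + Y) ≤ x i ^ 2 / X + y i ^ 2 / Y :=
      add_sq_div_add_le hX hY
    simp only [Pi.add_apply] at h4 ⊢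
    linarith

lemma le_of_hasDerivAt_of_forall_pos {f : ℝ → ℝ} {D c : ℝ} (hf : HasDerivAt f D 0)
    (h : ∀ t > 0, f 0 + t * c ≤ f t) : c ≤ D := by
  have := hf.tendsto_slope_zero_right
  refine ge_of_tendsto this ?_
  filter_upwards [self_mem_nhdsWithin] with t ht
  have ht' : 0 < t := ht
  have := h t ht
  rw [zero_add, smul_eq_mul, inv_mul_eq_div, le_div_iff₀ ht']
  linarith

/-- The gradient inequality for the concave function `log e_{m+1}` on the Gårding cone. -/
lemma IsGarding.log_div_le {s : Finset ι} {m : ℕ} {x y : ι → ℝ} (hx : IsGarding s (m + 1) x)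
    (hy : IsGarding s (m + 1) y) :
    (m + 1) + Real.log (esym s (m + 1) y / esym s (m + 1) x) ≤
      ∑ i ∈ s, esym (s.erase i) m x / esym s (m + 1) x * y i := by
  set r : ℕ → ℝ := fun k => esymQuot s k y / esymQuot s k x with hr
  have hqx : ∀ k ∈ range (m + 1), 0 < esymQuot s k x := fun k hk =>
    (hx.mono (by have := mem_range.1 hk; omega)).esymQuot_pos
  have hqy : ∀ k ∈ range (m + 1), 0 < esymQuot s k y := fun k hk =>
    (hy.mono (by have := mem_range.1 hk; omega)).esymQuot_pos
  have hr0 : ∀ k ∈ range (m + 1), 0 < r k := fun k hk => div_pos (hqy k hk) (hqx k hk)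
  have hex := hx (m + 1) le_rfl
  -- Telescoping `e_{m+1}` into quotients, superadditivity bounds `e_{m+1}(x + t y)` below by
  -- `e_{m+1}(x) ∏ (1 + t r_k)`. The one-sided slope at `t = 0` then suffices.
  have h1 : esym s (m + 1) x * ∑ k ∈ range (m + 1), r k ≤
      ∑ i ∈ s, y i * esym (s.erase i) m x := by
    have hd := hasDerivAt_esym s m x y 0
    simp only [zero_mul, add_zero] at hd
    refine le_of_hasDerivAt_of_forall_pos hd fun t ht => ?_
    simp only [zero_mul, add_zero]
    have hty : IsGarding s (m + 1) (fun i => t * y i) := hy.smul ht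
    have hs : IsGarding s (m + 1) (fun i => x i + t * y i) := (hx.add_and_esymQuot_add hty).1
    rw [← hs.prod_esymQuot]
    calc esym s (m + 1) x + t * (esym s (m + 1) x * ∑ k ∈ range (m + 1), r k)
        = esym s (m + 1) x * (1 + ∑ k ∈ range (m + 1), t * r k) := by rw [← mul_sum]; ring
      _ ≤ esym s (m + 1) x * ∏ k ∈ range (m + 1), (1 + t * r k) := by
        refine mul_le_mul_of_nonneg_left ?_ hex.le
        exact one_add_sum_le_prod_one_add _ fun k hk => (mul_pos ht (hr0 k hk)).le
      _ = ∏ k ∈ range (m + 1), (esymQuot s k x + t * esymQuot s k y) := by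
        rw [← hx.prod_esymQuot, ← prod_mul_distrib]
        refine prod_congr rfl fun k hk => ?_
        have := (hqx k hk).ne'
        simp only [hr]
        field_simp
      _ ≤ _ := by
        refine prod_le_prod (fun k hk => ?_) fun k hk => ?_
        · exact (add_pos (hqx k hk) (mul_pos ht (hqy k hk))).le
        · have hk' : k ≤ m + 1 := by have := mem_range.1 hk; omega
          rw [← esymQuot_smul ht.ne']
          exact ((hx.mono hk').add_and_esymQuot_add (hty.mono hk')).2
  have h2 : (m + 1) + Real.log (esym s (m + 1) y / esym s (m + 1) x) ≤
      ∑ k ∈ range (m + 1), r k := by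
    rw [← hy.prod_esymQuot, ← hx.prod_esymQuot, ← prod_div_distrib,
      Real.log_prod fun k hk => (hr0 k hk).ne']
    have : ∑ k ∈ range (m + 1), (1 + Real.log (r k)) ≤ ∑ k ∈ range (m + 1), r k :=
      sum_le_sum fun k hk => by have := Real.log_le_sub_one_of_pos (hr0 k hk); linarith
    rw [sum_add_distrib] at this
    simpa using this
  refine h2.trans ?_
  rw [← div_le_div_iff_of_pos_right hex, mul_div_cancel_left₀ _ hex.ne', sum_div] at h1
  refine h1.trans (le_of_eq (sum_congr rfl fun i _ => by ring))

end Garding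

/-! ### From eigenvalues to symmetric matrices -/

section Matrices

variable {d : ℕ}

lemma isHermitian_of_isSymm {w : Matrix (Fin d) (Fin d) ℝ} (h : w.IsSymm) : w.IsHermitian := by
  rw [Matrix.IsHermitian, Matrix.conjTranspose_eq_transpose_of_trivial]
  exact h

lemma P_eq_esym {w : Matrix (Fin d) (Fin d) ℝ} (h : w.IsHermitian) (m : ℕ) :
    P m w = esym univ m h.eigenvalues := by
  rw [P, h.roots_charpoly_eq_eigenvalues, esym_eq_multiset]
  rfl

lemma P_eq_coeff {w : Matrix (Fin d) (Fin d) ℝ} (h : w.IsHermitian) {m : ℕ} (hm : m ≤ d) :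
    P m w = (-1) ^ m * w.charpoly.coeff (d - m) := by
  have e : w.charpoly = ∏ i, (X + C (-1 * h.eigenvalues i)) := by
    rw [h.charpoly_eq]
    simp [sub_eq_add_neg]
  rw [P_eq_esym h, e, Finset.prod_X_add_C_coeff _ _ (by simp)]
  change _ = _ * esym _ _ _
  rw [esym_smul, card_univ, Fintype.card_fin, Nat.sub_sub_self hm, ← mul_assoc, ← mul_pow]
  simp

lemma continuous_charpoly_coeff (k : ℕ) :
    Continuous fun w : Matrix (Fin d) (Fin d) ℝ => w.charpoly.coeff k := by
  have e : (fun w : Matrix (Fin d) (Fin d) ℝ => w.charpoly.coeff k) = fun w =>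
      MvPolynomial.eval (fun p : Fin d × Fin d => w p.1 p.2)
        ((Matrix.charpoly.univ ℝ (Fin d)).coeff k) := by
    funext w
    exact (Matrix.charpoly.univ_coeff_eval₂Hom (Fin d) (RingHom.id ℝ)
      (fun p : Fin d × Fin d => w p.1 p.2) k).symm
  rw [e]
  refine (MvPolynomial.continuous_eval _).comp (continuous_pi fun p => ?_)
  exact continuous_id.matrix_elem p.1 p.2

lemma P_one_pos (k : ℕ) (hk : k ≤ d) : 0 < P k (1 : Matrix (Fin d) (Fin d) ℝ) := by
  have h : (1 : Matrix (Fin d) (Fin d) ℝ).IsHermitian := Matrix.isHermitian_one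
  have e : (1 : Matrix (Fin d) (Fin d) ℝ).charpoly.roots = Multiset.replicate d 1 := by
    rw [Matrix.charpoly_one, Fintype.card_fin, ← C_1, roots_pow, roots_X_sub_C,
      Multiset.nsmul_singleton]
  rw [P, e, Multiset.esymm]
  have : (Multiset.map Multiset.prod (Multiset.powersetCard k (Multiset.replicate d (1 : ℝ)))) =
      Multiset.replicate (d.choose k) 1 := by
    rw [Multiset.eq_replicate]
    refine ⟨by simp, fun b hb => ?_⟩
    obtain ⟨s, hs, rfl⟩ := Multiset.mem_map.1 hb
    refine Multiset.prod_eq_one fun x hx => ?_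
    exact Multiset.eq_of_mem_replicate (Multiset.mem_of_le (Multiset.mem_powersetCard.1 hs).1 hx)
  rw [this]
  simpa using Nat.choose_pos hk

lemma isSymm_of_mem_cone {m : ℕ} {w : Matrix (Fin d) (Fin d) ℝ} (h : w ∈ Cone d m) : w.IsSymm :=
  (connectedComponentIn_subset _ _ h).1

/-- The connected component of the identity in `{P_m > 0}` is contained in the Gårding cone. -/
lemma isGarding_of_mem_cone {m : ℕ} (hm : m ≤ d) {w : Matrix (Fin d) (Fin d) ℝ}
    (h : w ∈ Cone d m) (hw : w.IsHermitian) : IsGarding univ m hw.eigenvalues := by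
  -- `P` is built from the multiset of real roots; the characteristic coefficients agree with it on
  -- symmetric matrices and are continuous on all matrices, so `U` and `V` are open.
  set c : ℕ → Matrix (Fin d) (Fin d) ℝ → ℝ := fun k w => (-1) ^ k * w.charpoly.coeff (d - k)
  have hc : ∀ k, Continuous (c k) := fun k => (continuous_charpoly_coeff _).const_mul _
  have hPc : ∀ v : Matrix (Fin d) (Fin d) ℝ, v.IsSymm → ∀ k ≤ m, P k v = c k v := fun v hv k hk =>
    P_eq_coeff (isHermitian_of_isSymm hv) (hk.trans hm)
  set U : Set (Matrix (Fin d) (Fin d) ℝ) := ⋂ k ∈ Set.Iic m, {w | 0 < c k w}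
  set V : Set (Matrix (Fin d) (Fin d) ℝ) := ⋃ k ∈ Set.Iic m, {w | c k w < 0}
  have hU : IsOpen U :=
    (Set.finite_Iic m).isOpen_biInter fun k _ => isOpen_lt continuous_const (hc k)
  have hV : IsOpen V :=
    isOpen_biUnion fun k _ => isOpen_lt (hc k) continuous_const
  have hUV : Disjoint U V := by
    rw [Set.disjoint_left]
    intro v hv hv'
    obtain ⟨k, hk, hk'⟩ := Set.mem_iUnion₂.1 hv'
    have h1 : 0 < c k v := Set.mem_iInter₂.1 hv k hk
    have h2 : c k v < 0 := hk'
    exact lt_asymm h1 h2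
  have hcov : Cone d m ⊆ U ∪ V := by
    intro v hv
    obtain ⟨hs, hp⟩ := connectedComponentIn_subset _ _ hv
    by_cases hvV : v ∈ V
    · exact Or.inr hvV
    · refine Or.inl (Set.mem_iInter₂.2 fun k hk => ?_)
      have hH := isHermitian_of_isSymm hs
      have : IsGarding univ m hH.eigenvalues := by
        -- Outside `V` all `e_j` are nonnegative; with `P_m > 0`, strict Newton makes them positive.
        -- So `U` and `V` separate the component.
        refine IsGarding.of_nonneg (fun j hj => ?_) (by rwa [← P_eq_esym])
        rw [← P_eq_esym, hPc v hs j hj]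
        by_contra! hlt
        exact hvV (Set.mem_iUnion₂.2 ⟨j, hj, hlt⟩)
      have := this k hk
      rwa [← P_eq_esym, hPc v hs k hk] at this
  have h1 : (1 : Matrix (Fin d) (Fin d) ℝ) ∈ {w : Matrix (Fin d) (Fin d) ℝ | w.IsSymm ∧ 0 < P m w} :=
    ⟨Matrix.isSymm_one, P_one_pos m hm⟩
  have h1U : (1 : Matrix (Fin d) (Fin d) ℝ) ∈ U := Set.mem_iInter₂.2 fun k hk => by
    have := P_one_pos k (le_trans hk hm)
    rwa [hPc 1 Matrix.isSymm_one k hk] at this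
  have hsub : Cone d m ⊆ U :=
    isPreconnected_connectedComponentIn.subset_left_of_subset_union hU hV hUV hcov
      ⟨1, mem_connectedComponentIn h1, h1U⟩
  intro k hk
  have := Set.mem_iInter₂.1 (hsub h) k hk
  rwa [← P_eq_esym, hPc w (isSymm_of_mem_cone h) k hk]

/-- The quadratic form of a matrix. -/
noncomputable def quad (w : Matrix (Fin d) (Fin d) ℝ) (ξ : EuclideanSpace ℝ (Fin d)) : ℝ :=
  ∑ i, ∑ j, ξ i * ξ j * w i j

lemma quad_eq_inner (w : Matrix (Fin d) (Fin d) ℝ) (ξ : EuclideanSpace ℝ (Fin d)) :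
    quad w ξ = inner ℝ ξ (Matrix.toEuclideanLin w ξ) := by
  simp only [quad, PiLp.inner_apply, Matrix.toLpLin_apply, Matrix.mulVec, dotProduct]
  refine sum_congr rfl fun i _ => ?_
  simp only [RCLike.inner_apply, conj_trivial, sum_mul]
  exact sum_congr rfl fun j _ => by ring

lemma quad_eq_sum {w : Matrix (Fin d) (Fin d) ℝ} (hw : w.IsHermitian)
    (ξ : EuclideanSpace ℝ (Fin d)) :
    quad w ξ = ∑ j, inner ℝ ξ (hw.eigenvectorBasis j) ^ 2 * hw.eigenvalues j := by
  rw [quad_eq_inner, ← hw.eigenvectorBasis.sum_inner_mul_inner]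
  refine sum_congr rfl fun j _ => ?_
  have hS := Matrix.isSymmetric_toEuclideanLin_iff.2 hw
  have e : Matrix.toEuclideanLin w (hw.eigenvectorBasis j) =
      hw.eigenvalues j • hw.eigenvectorBasis j := by
    rw [Matrix.toLpLin_apply, hw.mulVec_eigenvectorBasis]
    rfl
  rw [← hS, e, inner_smul_left, real_inner_comm]
  simp
  ring

lemma trace_eq_sum_quad (w : Matrix (Fin d) (Fin d) ℝ)
    (b : OrthonormalBasis (Fin d) ℝ (EuclideanSpace ℝ (Fin d))) :
    w.trace = ∑ i, quad w (b i) := by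
  simp only [quad_eq_inner]
  rw [← LinearMap.trace_eq_sum_inner, Matrix.toEuclideanLin_eq_toLin_orthonormal,
    Matrix.trace_toLin_eq]

lemma matNorm_sq {w : Matrix (Fin d) (Fin d) ℝ} (hw : w.IsHermitian) :
    ∑ i, ∑ j, w i j ^ 2 = ∑ i, hw.eigenvalues i ^ 2 := by
  have h1 : ∑ i, ∑ j, w i j ^ 2 = (w * w).trace := by
    simp only [Matrix.trace, Matrix.diag, Matrix.mul_apply]
    refine sum_congr rfl fun i _ => sum_congr rfl fun j _ => ?_
    rw [sq]
    congr 1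
    have := hw.apply i j
    simpa using this.symm
  rw [h1]
  conv_lhs => rw [hw.spectral_theorem, ← map_mul]
  rw [Unitary.conjStarAlgAut_apply, Matrix.trace_mul_cycle]
  simp [Matrix.diagonal_mul_diagonal, Matrix.trace_diagonal, sq]

lemma sum_eq_esym_sq {ι : Type*} [DecidableEq ι] (s : Finset ι) (x : ι → ℝ) :
    ∑ i ∈ s, x i ^ 2 = esym s 1 x ^ 2 - 2 * esym s 2 x := by
  have h := sum_mul_esym_erase s 1 x
  have h2 : ∑ i ∈ s, x i * esym (s.erase i) 1 x = ∑ i ∈ s, (x i * esym s 1 x - x i ^ 2) := by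
    refine sum_congr rfl fun i hi => ?_
    have := esym_erase hi 0 x
    simp only [zero_add, esym_zero, mul_one] at this
    rw [this]; ring
  rw [h2, sum_sub_distrib, ← sum_mul, ← esym_one] at h
  norm_num at h
  linarith

lemma matNorm_le_trace {w : Matrix (Fin d) (Fin d) ℝ} (hw : w.IsHermitian)
    (h : IsGarding univ 2 hw.eigenvalues) : matNorm w ≤ w.trace := by
  have ht : w.trace = esym univ 1 hw.eigenvalues := by
    rw [hw.trace_eq_sum_eigenvalues, esym_one]; rfl
  rw [matNorm, ht]
  refine Real.sqrt_le_iff.2 ⟨(h 1 (by norm_num)).le, ?_⟩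
  rw [matNorm_sq hw, sum_eq_esym_sq]
  have := h 2 le_rfl
  linarith

lemma trace_le_matNorm (w : Matrix (Fin d) (Fin d) ℝ) : w.trace ≤ d * matNorm w := by
  have : ∀ i, w i i ≤ matNorm w := fun i => by
    refine Real.le_sqrt_of_sq_le ?_
    calc w i i ^ 2 ≤ ∑ j, w i j ^ 2 :=
          single_le_sum (f := fun j => w i j ^ 2) (fun j _ => sq_nonneg _) (mem_univ i)
      _ ≤ _ := single_le_sum (f := fun i => ∑ j, w i j ^ 2)
          (fun i _ => sum_nonneg fun j _ => sq_nonneg _) (mem_univ i)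
  calc w.trace = ∑ i, w i i := rfl
    _ ≤ ∑ _i : Fin d, matNorm w := sum_le_sum fun i _ => this i
    _ = _ := by simp

/-- The diagonal of a symmetric matrix in another orthonormal basis is this matrix applied to its
eigenvalues; Birkhoff's theorem then reduces matrix inequalities to permuted eigenvalues. -/
lemma sq_inner_mem_doublyStochastic
    (a b : OrthonormalBasis (Fin d) ℝ (EuclideanSpace ℝ (Fin d))) :
    (Matrix.of fun i j => inner ℝ (a i) (b j) ^ 2) ∈ doublyStochastic ℝ (Fin d) := by
  rw [mem_doublyStochastic_iff_sum]
  refine ⟨fun i j => sq_nonneg _, fun i => ?_, fun j => ?_⟩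
  · have := b.sum_sq_norm_inner_left (a i)
    simpa using this
  · have := a.sum_sq_norm_inner_right (b j)
    simpa using this

/-- A linear functional bounded below on permutation matrices is bounded below on doubly
stochastic matrices. -/
lemma le_sum_of_forall_perm {M : Matrix (Fin d) (Fin d) ℝ} (hM : M ∈ doublyStochastic ℝ (Fin d))
    {l y : Fin d → ℝ} {c : ℝ} (h : ∀ σ : Equiv.Perm (Fin d), c ≤ ∑ i, l i * y (σ i)) :
    c ≤ ∑ i, l i * ∑ j, M i j * y j := by
  rw [← SetLike.mem_coe, doublyStochastic_eq_convexHull_permMatrix] at hM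
  have hconv : Convex ℝ {M : Matrix (Fin d) (Fin d) ℝ | c ≤ ∑ i, l i * ∑ j, M i j * y j} := by
    refine convex_halfSpace_ge (f := fun M : Matrix (Fin d) (Fin d) ℝ =>
      ∑ i, l i * ∑ j, M i j * y j) ⟨fun A B => ?_, fun t A => ?_⟩ c
    · simp only [Matrix.add_apply, add_mul, sum_add_distrib, mul_add]
    · simp only [Matrix.smul_apply, smul_eq_mul, mul_sum]
      exact sum_congr rfl fun i _ => sum_congr rfl fun j _ => by ring
  refine convexHull_min ?_ hconv hM
  rintro _ ⟨σ, rfl⟩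
  refine (h σ).trans (le_of_eq ?_)
  refine sum_congr rfl fun i _ => ?_
  simp [Equiv.Perm.permMatrix, PEquiv.toMatrix_apply, eq_comm]

/-- The gradient inequality for `log P_{m+1}` on matrices. -/
lemma log_P_le {m : ℕ} {w v : Matrix (Fin d) (Fin d) ℝ} (hw : w.IsHermitian) (hv : v.IsHermitian)
    (gw : IsGarding univ (m + 1) hw.eigenvalues) (gv : IsGarding univ (m + 1) hv.eigenvalues) :
    (m + 1) + Real.log (P (m + 1) v / P (m + 1) w) ≤
      ∑ i, esym (univ.erase i) m hw.eigenvalues / P (m + 1) w * quad v (hw.eigenvectorBasis i) := by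
  simp only [quad_eq_sum hv]
  refine le_sum_of_forall_perm
    (sq_inner_mem_doublyStochastic hw.eigenvectorBasis hv.eigenvectorBasis)
    (l := fun i => esym (univ.erase i) m hw.eigenvalues / P (m + 1) w) fun σ => ?_
  have gσ : IsGarding univ (m + 1) (hv.eigenvalues ∘ σ) := fun j hj => by
    rw [esym_comp_perm]; exact gv j hj
  have := gw.log_div_le gσ
  rwa [esym_comp_perm, ← P_eq_esym hv, ← P_eq_esym hw] at this

lemma sum_mul_eigenvalues_eq {m : ℕ} {w : Matrix (Fin d) (Fin d) ℝ} (hw : w.IsHermitian)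
    (hP : P (m + 1) w ≠ 0) :
    ∑ i, esym (univ.erase i) m hw.eigenvalues / P (m + 1) w * hw.eigenvalues i = m + 1 := by
  have h := sum_mul_esym_erase univ m hw.eigenvalues
  rw [← P_eq_esym hw] at h
  rw [eq_comm, ← mul_div_cancel_right₀ ((m : ℝ) + 1) hP, ← h, sum_div]
  exact sum_congr rfl fun i _ => by ring

/-- Lower bound for the trace of the linearization of `log P_{m+2}`. -/
lemma one_div_le_sum {m : ℕ} (hm : m + 2 ≤ d) {w : Matrix (Fin d) (Fin d) ℝ} (hw : w.IsHermitian)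
    (gw : IsGarding univ (m + 2) hw.eigenvalues) {g : ℝ} (hg : 0 < g)
    (hP : P (m + 2) w = g ^ (m + 1)) (ht : 1 ≤ w.trace) :
    1 / g ≤ ∑ i, esym (univ.erase i) (m + 1) hw.eigenvalues / P (m + 2) w := by
  have htr : w.trace = esym univ 1 hw.eigenvalues := by
    rw [hw.trace_eq_sum_eigenvalues, esym_one]; rfl
  have h1 := gw.esym_pow_mul_le
  rw [← htr, ← P_eq_esym hw, hP] at h1
  -- The exponent of `g` in the equation makes the right side an exact power, so an `(m + 1)`-th
  -- root can be taken.
  have h2 : g ^ m ≤ esym univ (m + 1) hw.eigenvalues := by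
    refine le_of_pow_le_pow_left₀ (Nat.succ_ne_zero m) (gw (m + 1) (by omega)).le ?_
    calc (g ^ m) ^ (m + 1) = (g ^ (m + 1)) ^ m * 1 := by ring
      _ ≤ (g ^ (m + 1)) ^ m * w.trace := mul_le_mul_of_nonneg_left ht (by positivity)
      _ ≤ _ := h1
  rw [← sum_div, sum_esym_erase, hP, card_univ, Fintype.card_fin, div_le_div_iff₀ hg (by positivity)]
  have h3 : (1 : ℝ) ≤ d - (m + 1 : ℕ) := by
    have : ((m + 2 : ℕ) : ℝ) ≤ d := by exact_mod_cast hm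
    push_cast at this ⊢
    linarith
  have hgm : 0 < g ^ m := by positivity
  have h4 : g ^ m ≤ (d - (m + 1 : ℕ)) * esym univ (m + 1) hw.eigenvalues := by nlinarith
  calc 1 * g ^ (m + 1) = g ^ m * g := by ring
    _ ≤ _ := mul_le_mul_of_nonneg_right h4 hg.le

lemma quad_eigenvectorBasis {w : Matrix (Fin d) (Fin d) ℝ} (hw : w.IsHermitian) (i : Fin d) :
    quad w (hw.eigenvectorBasis i) = hw.eigenvalues i := by
  rw [quad_eq_sum hw, sum_eq_single i]
  · simp
  · intro j _ hj
    rw [hw.eigenvectorBasis.inner_eq_zero hj.symm]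
    simp
  · simp

end Matrices

open Finset Filter

/-! ### Calculus of directional derivatives -/

section DirectionalDerivatives

/-- A negative second derivative would also give a local maximum, hence local constancy and a zero
second derivative. -/
lemma deriv_deriv_nonneg_of_isLocalMin {f : ℝ → ℝ} {a : ℝ} (h : IsLocalMin f a)
    (hc : ContinuousAt f a) : 0 ≤ deriv (deriv f) a := by
  by_contra! hneg
  have h1 := isLocalMax_of_deriv_deriv_neg hneg h.deriv_eq_zero hc
  have h2 : f =ᶠ[𝓝 a] fun _ => f a := by
    filter_upwards [h, h1] with x hx hx'
    exact le_antisymm hx' hx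
  have h3 := h2.deriv.deriv_eq
  simp at h3
  linarith

variable {E : Type*} [NormedAddCommGroup E] [NormedSpace ℝ E]

/-- The derivative of `f` in the direction `ξ`. -/
noncomputable def dirDeriv (ξ : E) (f : E → ℝ) (x : E) : ℝ := fderiv ℝ f x ξ

variable {D : Set E} {f g : E → ℝ} {x ξ η : E}

lemma dirDeriv_congr (hD : IsOpen D) (h : Set.EqOn f g D) :
    Set.EqOn (dirDeriv ξ f) (dirDeriv ξ g) D := fun x hx => by
  have : f =ᶠ[𝓝 x] g := h.eventuallyEq_of_mem (hD.mem_nhds hx)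
  rw [dirDeriv, dirDeriv, this.fderiv_eq]

lemma contDiffOn_dirDeriv {n : ℕ} (hD : IsOpen D) (hf : ContDiffOn ℝ (n + 1 : ℕ) f D) :
    ContDiffOn ℝ n (dirDeriv ξ f) D :=
  (hf.fderiv_of_isOpen hD (by norm_cast)).clm_apply contDiffOn_const

lemma differentiableAt_of_contDiffOn {n : ℕ} (hD : IsOpen D) (hf : ContDiffOn ℝ (n + 1 : ℕ) f D)
    (hx : x ∈ D) : DifferentiableAt ℝ f x :=
  (hf.contDiffAt (hD.mem_nhds hx)).differentiableAt (by norm_cast)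

lemma dirDeriv_dirDeriv_apply (hD : IsOpen D) (hf : ContDiffOn ℝ (2 : ℕ) f D) (hx : x ∈ D) :
    dirDeriv ξ (dirDeriv η f) x = fderiv ℝ (fderiv ℝ f) x ξ η := by
  have h : DifferentiableAt ℝ (fderiv ℝ f) x :=
    ((hf.fderiv_of_isOpen hD (m := 1) (by norm_cast)).contDiffAt (hD.mem_nhds hx)).differentiableAt
      (by norm_cast)
  have := h.hasFDerivAt.clm_apply (hasFDerivAt_const η x)
  change fderiv ℝ (fun y => fderiv ℝ f y η) x ξ = _
  rw [this.fderiv]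
  simp

lemma dirDeriv_comm (hD : IsOpen D) (hf : ContDiffOn ℝ (2 : ℕ) f D) (hx : x ∈ D) :
    dirDeriv ξ (dirDeriv η f) x = dirDeriv η (dirDeriv ξ f) x := by
  rw [dirDeriv_dirDeriv_apply hD hf hx, dirDeriv_dirDeriv_apply hD hf hx]
  have : IsSymmSndFDerivAt ℝ f x :=
    (hf.contDiffAt (hD.mem_nhds hx)).isSymmSndFDerivAt (by simp)
  exact this ξ η

/-- The second derivative of `f` in the direction `ξ`. -/
noncomputable def dirDeriv₂ (ξ : E) (f : E → ℝ) : E → ℝ := dirDeriv ξ (dirDeriv ξ f)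

lemma contDiffOn_dirDeriv₂ {n : ℕ} (hD : IsOpen D) (hf : ContDiffOn ℝ (n + 2 : ℕ) f D) :
    ContDiffOn ℝ n (dirDeriv₂ ξ f) D :=
  contDiffOn_dirDeriv hD (contDiffOn_dirDeriv hD hf)

lemma dirDeriv_dirDeriv₂ (hD : IsOpen D) (hf : ContDiffOn ℝ (3 : ℕ) f D) :
    Set.EqOn (dirDeriv ξ (dirDeriv₂ η f)) (dirDeriv₂ η (dirDeriv ξ f)) D := fun y hy => by
  have h1 : ContDiffOn ℝ (2 : ℕ) (dirDeriv η f) D := contDiffOn_dirDeriv hD hf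
  rw [dirDeriv₂, dirDeriv_comm hD h1 hy]
  exact dirDeriv_congr hD (fun z hz => dirDeriv_comm hD (hf.of_le (by norm_cast)) hz) hy

lemma dirDeriv₂_comm (hD : IsOpen D) (hf : ContDiffOn ℝ (4 : ℕ) f D) (hx : x ∈ D) :
    dirDeriv₂ ξ (dirDeriv₂ η f) x = dirDeriv₂ η (dirDeriv₂ ξ f) x := by
  have h3 : ContDiffOn ℝ (3 : ℕ) f D := hf.of_le (by norm_cast)
  have h1 : ContDiffOn ℝ (3 : ℕ) (dirDeriv ξ f) D := contDiffOn_dirDeriv hD hf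
  rw [dirDeriv₂, dirDeriv_congr hD (dirDeriv_dirDeriv₂ hD h3) hx, dirDeriv_dirDeriv₂ hD h1 hx]
  rfl

lemma dirDeriv_add (hf : DifferentiableAt ℝ f x) (hg : DifferentiableAt ℝ g x) :
    dirDeriv ξ (fun y => f y + g y) x = dirDeriv ξ f x + dirDeriv ξ g x := by
  rw [dirDeriv, fderiv_fun_add hf hg]
  rfl

lemma dirDeriv_const_mul (hf : DifferentiableAt ℝ f x) (c : ℝ) :
    dirDeriv ξ (fun y => c * f y) x = c * dirDeriv ξ f x := by
  rw [dirDeriv, fderiv_const_mul hf]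
  rfl

lemma dirDeriv_mul (hf : DifferentiableAt ℝ f x) (hg : DifferentiableAt ℝ g x) :
    dirDeriv ξ (fun y => f y * g y) x = f x * dirDeriv ξ g x + g x * dirDeriv ξ f x := by
  rw [dirDeriv, fderiv_fun_mul hf hg]
  rfl

lemma dirDeriv₂_add (hD : IsOpen D) (hf : ContDiffOn ℝ (2 : ℕ) f D) (hg : ContDiffOn ℝ (2 : ℕ) g D)
    (hx : x ∈ D) :
    dirDeriv₂ ξ (fun y => f y + g y) x = dirDeriv₂ ξ f x + dirDeriv₂ ξ g x := by
  rw [dirDeriv₂, dirDeriv_congr hD (fun y hy => dirDeriv_add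
    (differentiableAt_of_contDiffOn hD hf hy) (differentiableAt_of_contDiffOn hD hg hy)) hx]
  exact dirDeriv_add (differentiableAt_of_contDiffOn (n := 0) hD (contDiffOn_dirDeriv hD hf) hx)
    (differentiableAt_of_contDiffOn (n := 0) hD (contDiffOn_dirDeriv hD hg) hx)

lemma dirDeriv₂_const_mul (hD : IsOpen D) (hf : ContDiffOn ℝ (2 : ℕ) f D) (c : ℝ) (hx : x ∈ D) :
    dirDeriv₂ ξ (fun y => c * f y) x = c * dirDeriv₂ ξ f x := by
  rw [dirDeriv₂, dirDeriv_congr hD (fun y hy => dirDeriv_const_mul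
    (differentiableAt_of_contDiffOn hD hf hy) c) hx]
  exact dirDeriv_const_mul
    (differentiableAt_of_contDiffOn (n := 0) hD (contDiffOn_dirDeriv hD hf) hx) c

lemma dirDeriv₂_sum {ι : Type*} (s : Finset ι) {F : ι → E → ℝ} (c : ι → ℝ) (hD : IsOpen D)
    (hF : ∀ i ∈ s, ContDiffOn ℝ (2 : ℕ) (F i) D) (hx : x ∈ D) :
    dirDeriv₂ ξ (fun y => ∑ i ∈ s, c i * F i y) x = ∑ i ∈ s, c i * dirDeriv₂ ξ (F i) x := by
  classical
  induction s using Finset.induction_on with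
  | empty =>
    have e : dirDeriv ξ (fun _ : E => (0 : ℝ)) = fun _ => 0 := by funext y; simp [dirDeriv]
    simp [dirDeriv₂, e]
  | insert a s ha ih =>
    have h1 := hF a (mem_insert_self _ _)
    have h2 : ∀ i ∈ s, ContDiffOn ℝ (2 : ℕ) (F i) D := fun i hi => hF i (mem_insert_of_mem hi)
    simp only [sum_insert ha]
    rw [dirDeriv₂_add hD (contDiffOn_const.mul h1)
      (ContDiffOn.sum fun i hi => contDiffOn_const.mul (h2 i hi)) hx,
      dirDeriv₂_const_mul hD h1 _ hx, ih h2]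

lemma dirDeriv₂_log (hD : IsOpen D) (hf : ContDiffOn ℝ (2 : ℕ) f D) (hpos : ∀ y ∈ D, 0 < f y)
    (hx : x ∈ D) :
    dirDeriv₂ ξ (fun y => Real.log (f y)) x =
      dirDeriv₂ ξ f x / f x - dirDeriv ξ f x ^ 2 / f x ^ 2 := by
  have h1 : Set.EqOn (dirDeriv ξ fun y => Real.log (f y))
      (fun y => dirDeriv ξ f y * (f y)⁻¹) D := fun y hy => by
    rw [dirDeriv, fderiv.log (differentiableAt_of_contDiffOn hD hf hy) (hpos y hy).ne']
    simp [dirDeriv, mul_comm]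
  have hdf := differentiableAt_of_contDiffOn hD hf hx
  have h2 : dirDeriv ξ (fun y => (f y)⁻¹) x = - dirDeriv ξ f x / f x ^ 2 := by
    have := (hasDerivAt_inv (hpos x hx).ne').comp_hasFDerivAt x hdf.hasFDerivAt
    rw [dirDeriv, show (fun y => (f y)⁻¹) = Inv.inv ∘ f from rfl, this.fderiv]
    simp [dirDeriv]
    ring
  have hinv : DifferentiableAt ℝ (fun y => (f y)⁻¹) x := hdf.inv (hpos x hx).ne'
  rw [dirDeriv₂, dirDeriv_congr hD h1 hx, dirDeriv_mul
    (differentiableAt_of_contDiffOn (n := 0) hD (contDiffOn_dirDeriv hD hf) hx)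
    hinv, h2, dirDeriv₂]
  have := (hpos x hx).ne'
  field_simp
  ring

lemma hasDerivAt_line {t : ℝ} (hf : DifferentiableAt ℝ f (x + t • ξ)) :
    HasDerivAt (fun t : ℝ => f (x + t • ξ)) (dirDeriv ξ f (x + t • ξ)) t := by
  have h : HasDerivAt (fun t : ℝ => x + t • ξ) ξ t := by
    simpa using ((hasDerivAt_id t).smul_const ξ).const_add x
  exact hf.hasFDerivAt.comp_hasDerivAt t h

lemma eventually_line_mem (hD : IsOpen D) (hx : x ∈ D) : ∀ᶠ t : ℝ in 𝓝 0, x + t • ξ ∈ D := by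
  have hc : Continuous fun t : ℝ => x + t • ξ := by fun_prop
  exact hc.continuousAt.preimage_mem_nhds (hD.mem_nhds (by simpa using hx))

lemma deriv_deriv_line (hD : IsOpen D) (hf : ContDiffOn ℝ (2 : ℕ) f D) (hx : x ∈ D) :
    deriv (deriv fun t : ℝ => f (x + t • ξ)) 0 = dirDeriv₂ ξ f x := by
  have e : deriv (fun t : ℝ => f (x + t • ξ)) =ᶠ[𝓝 0] fun t => dirDeriv ξ f (x + t • ξ) := by
    filter_upwards [eventually_line_mem hD hx] with t ht
    exact (hasDerivAt_line (differentiableAt_of_contDiffOn hD hf ht)).deriv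
  rw [e.deriv_eq]
  have : DifferentiableAt ℝ (dirDeriv ξ f) (x + (0 : ℝ) • ξ) := by
    rw [zero_smul, add_zero]
    exact differentiableAt_of_contDiffOn (n := 0) hD (contDiffOn_dirDeriv hD hf) hx
  simpa using! (hasDerivAt_line this).deriv

lemma dirDeriv₂_nonneg_of_isMinOn (hD : IsOpen D) (hf : ContDiffOn ℝ (2 : ℕ) f D) (hx : x ∈ D)
    (hmin : ∀ y ∈ D, f x ≤ f y) : 0 ≤ dirDeriv₂ ξ f x := by
  rw [← deriv_deriv_line hD hf hx]
  have hx0 : x + (0 : ℝ) • ξ = x := by simp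
  refine deriv_deriv_nonneg_of_isLocalMin ?_ ?_
  · filter_upwards [eventually_line_mem (ξ := ξ) hD hx] with t ht
    simpa using hmin _ ht
  · exact (hasDerivAt_line (hx0.symm ▸ differentiableAt_of_contDiffOn hD hf hx)).continuousAt

lemma dirDeriv₂_nonneg_of_convex (hD : IsOpen D) (hf : ContDiffOn ℝ (2 : ℕ) f D) (hx : x ∈ D)
    (hconv : ∀ a b : E, segment ℝ a b ⊆ D → ConvexOn ℝ (segment ℝ a b) f) :
    0 ≤ dirDeriv₂ ξ f x := by
  obtain ⟨ε, hε, hball⟩ := Metric.eventually_nhds_iff_ball.1 (eventually_line_mem (ξ := ξ) hD hx)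
  set φ : ℝ → ℝ := fun t => f (x + t • ξ) with hφ
  have hseg : ∀ t ∈ Set.Ioo (-ε) ε, x + t • ξ ∈ D := fun t ht => hball t (by
    rw [Metric.mem_ball, dist_zero_right, Real.norm_eq_abs, abs_lt]; exact ht)
  have hφc : ConvexOn ℝ (Set.Ioo (-ε) ε) φ := by
    refine ⟨convex_Ioo _ _, fun s hs t ht a b ha hb hab => ?_⟩
    have key : ∀ p q : ℝ, p + q = 1 →
        p • (x + s • ξ) + q • (x + t • ξ) = x + (p • s + q • t) • ξ := fun p q hpq => by
      calc _ = (p + q) • x + (p • s + q • t) • ξ := by simp only [smul_eq_mul]; module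
        _ = _ := by rw [hpq, one_smul]
    have hsub : segment ℝ (x + s • ξ) (x + t • ξ) ⊆ D := by
      rintro _ ⟨p, q, hp, hq, hpq, rfl⟩
      rw [key p q hpq]
      exact hseg _ (convex_Ioo _ _ hs ht hp hq hpq)
    have := (hconv _ _ hsub).2 (left_mem_segment ℝ _ _) (right_mem_segment ℝ _ _) ha hb hab
    rwa [key a b hab] at this
  have hφd : ∀ t ∈ Set.Ioo (-ε) ε, DifferentiableAt ℝ φ t := fun t ht =>
    (hasDerivAt_line (differentiableAt_of_contDiffOn hD hf (hseg t ht))).differentiableAt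
  have hmono := hφc.monotoneOn_deriv hφd
  rw [← deriv_deriv_line hD hf hx]
  have h0 : Set.Ioo (-ε) ε ∈ 𝓝 (0 : ℝ) := Ioo_mem_nhds (by linarith) hε
  rw [← derivWithin_of_mem_nhds h0]
  exact hmono.derivWithin_nonneg

end DirectionalDerivatives

/-! ### The squared distance -/

section Euclidean

variable {E : Type*} [NormedAddCommGroup E] [InnerProductSpace ℝ E]

lemma dirDeriv₂_norm_sub_sq (x₀ x ξ : E) :
    dirDeriv₂ ξ (fun y => ‖y - x₀‖ ^ 2) x = 2 * ‖ξ‖ ^ 2 := by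
  have h1 : dirDeriv ξ (fun y => ‖y - x₀‖ ^ 2) = fun y => 2 * inner ℝ (y - x₀) ξ := by
    funext y
    have := ((hasFDerivAt_id y).sub_const x₀).norm_sq
    rw [dirDeriv]
    erw [this.fderiv]
    simp [inner_sub_left]
  rw [dirDeriv₂, h1]
  have h2 : HasFDerivAt (fun y => 2 * inner ℝ (y - x₀) ξ) ((2 : ℝ) • innerSL ℝ ξ) x := by
    have : HasFDerivAt (fun y => innerSL ℝ ξ (y - x₀)) (innerSL ℝ ξ) x :=
      (innerSL ℝ ξ).hasFDerivAt.comp x ((hasFDerivAt_id x).sub_const x₀)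
    simpa [real_inner_comm] using this.const_mul 2
  rw [dirDeriv, h2.fderiv]
  simp

end Euclidean

/-! ### The interior maximum -/

section Hessian

variable {d : ℕ} {D : Set (EuclideanSpace ℝ (Fin d))} {g u : EuclideanSpace ℝ (Fin d) → ℝ}

lemma quad_hess (hD : IsOpen D) (hu : ContDiffOn ℝ (2 : ℕ) u D) {x : EuclideanSpace ℝ (Fin d)}
    (hx : x ∈ D) (ξ : EuclideanSpace ℝ (Fin d)) : quad (hess u x) ξ = dirDeriv₂ ξ u x := by
  rw [dirDeriv₂, dirDeriv_dirDeriv_apply hD hu hx]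
  have e : ξ = ∑ i, ξ i • EuclideanSpace.single i (1 : ℝ) := by
    have := (EuclideanSpace.basisFun (Fin d) ℝ).sum_repr ξ
    simpa using this.symm
  conv_rhs => rw [e]
  simp only [map_sum, map_smul, _root_.sum_apply, _root_.smul_apply,
    smul_eq_mul, quad, hess, Matrix.of_apply, iteratedFDeriv_two_apply, mul_sum]
  rw [sum_comm]
  refine sum_congr rfl fun i _ => sum_congr rfl fun j _ => ?_
  simp
  ring

lemma sq_dirDeriv_le_sq_norm_gradient {x : EuclideanSpace ℝ (Fin d)} {ξ : EuclideanSpace ℝ (Fin d)}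
    (hξ : ‖ξ‖ = 1) : dirDeriv ξ g x ^ 2 ≤ ‖gradient g x‖ ^ 2 := by
  have h : dirDeriv ξ g x = inner ℝ (gradient g x) ξ := by
    rw [dirDeriv, gradient, InnerProductSpace.toDual_symm_apply]
  rw [h, sq_le_sq, abs_of_nonneg (norm_nonneg (gradient g x))]
  simpa [hξ] using abs_real_inner_le_norm (gradient g x) ξ

/-- Lower bound for the pure second derivatives of `log g`. -/
lemma neg_le_dirDeriv₂_log {K : ℝ} (hD : IsOpen D) (hg : ContDiffOn ℝ (2 : ℕ) g D)
    (hpos : ∀ x ∈ D, 0 < g x)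
    (hconv : ConvexAlongSegments (closure D) (fun x => g x + K * ‖x‖ ^ 2))
    (hgrad : ∀ x ∈ D, ‖gradient g x‖ ^ 2 ≤ K * g x) {x : EuclideanSpace ℝ (Fin d)} (hx : x ∈ D)
    {ξ : EuclideanSpace ℝ (Fin d)} (hξ : ‖ξ‖ = 1) :
    -(3 * K / g x) ≤ dirDeriv₂ ξ (fun y => Real.log (g y)) x := by
  have hsq : ContDiffOn ℝ (2 : ℕ) (fun y : EuclideanSpace ℝ (Fin d) => ‖y - 0‖ ^ 2) D :=
    ((contDiff_id.sub contDiff_const).norm_sq ℝ).contDiffOn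
  have h1 : 0 ≤ dirDeriv₂ ξ (fun y => g y + K * ‖y - 0‖ ^ 2) x := by
    refine dirDeriv₂_nonneg_of_convex hD (hg.add (contDiffOn_const.mul hsq)) hx fun a b hab => ?_
    simpa using hconv a b (hab.trans subset_closure)
  rw [dirDeriv₂_add hD hg (contDiffOn_const.mul hsq) hx, dirDeriv₂_const_mul hD hsq _ hx,
    dirDeriv₂_norm_sub_sq, hξ] at h1
  have h2 := (sq_dirDeriv_le_sq_norm_gradient hξ).trans
    (hgrad x hx)
  have hp := hpos x hx
  rw [dirDeriv₂_log hD hg hpos hx]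
  -- The `3K` splits as `2K` from semiconvexity and `K` from the gradient bound, both divided by
  -- `g`.
  have h3 : dirDeriv ξ g x ^ 2 / g x ^ 2 ≤ K / g x := by
    rw [div_le_div_iff₀ (by positivity) hp]
    nlinarith
  have h4 : -(2 * K / g x) ≤ dirDeriv₂ ξ g x / g x := by
    rw [← neg_div]
    exact div_le_div_of_nonneg_right (by linarith) hp.le
  have h5 : 3 * K / g x = 2 * K / g x + K / g x := by ring
  linarith

/-- At an interior maximum of `Δu + A |x - x₀|²` the Laplacian of `u` is less than one. -/
lemma trace_hess_lt_one {m : ℕ} {K A : ℝ} (hm : m + 2 ≤ d) (hK : 0 ≤ K) (hA : 3 * d ^ 2 * K < 2 * A)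
    (hD : IsOpen D) (hg : ContDiffOn ℝ (2 : ℕ) g D) (hpos : ∀ x ∈ D, 0 < g x)
    (hconv : ConvexAlongSegments (closure D) (fun x => g x + K * ‖x‖ ^ 2))
    (hgrad : ∀ x ∈ D, ‖gradient g x‖ ^ 2 ≤ K * g x) (hu : ContDiffOn ℝ (4 : ℕ) u D)
    (hcone : ∀ x ∈ D, hess u x ∈ Cone d (m + 2))
    (heq : ∀ x ∈ D, P (m + 2) (hess u x) = g x ^ (m + 1)) {x₀ z : EuclideanSpace ℝ (Fin d)}
    (hz : z ∈ D)
    (hmax : ∀ x ∈ D, (hess u x).trace + A * ‖x - x₀‖ ^ 2 ≤ (hess u z).trace + A * ‖z - x₀‖ ^ 2) :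
    (hess u z).trace < 1 := by
  by_contra! ht
  have hH : ∀ x ∈ D, (hess u x).IsHermitian := fun x hx =>
    isHermitian_of_isSymm (isSymm_of_mem_cone (hcone x hx))
  have hG : ∀ x (hx : x ∈ D), IsGarding univ (m + 2) (hH x hx).eigenvalues := fun x hx =>
    isGarding_of_mem_cone hm (hcone x hx) _
  have hu2 : ContDiffOn ℝ (2 : ℕ) u D := hu.of_le (by norm_cast)
  set b := (hH z hz).eigenvectorBasis with hb
  set l : Fin d → ℝ := fun i =>
    esym (univ.erase i) (m + 1) (hH z hz).eigenvalues / P (m + 2) (hess u z) with hl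
  set U : Fin d → EuclideanSpace ℝ (Fin d) → ℝ := fun i => dirDeriv₂ (b i) u with hU
  have hUc : ∀ i, ContDiffOn ℝ (2 : ℕ) (U i) D := fun i => contDiffOn_dirDeriv₂ hD hu
  have hnorm : ∀ i, ‖b i‖ = 1 := fun i => b.orthonormal.1 i
  have hgz := hpos z hz
  have hPpos : 0 < P (m + 2) (hess u z) := by rw [heq z hz]; positivity
  have hl0 : ∀ i, 0 ≤ l i := fun i =>
    div_nonneg ((hG z hz).erase (mem_univ i) _ le_rfl).le hPpos.le
  have hlsum : 1 / g z ≤ ∑ i, l i := one_div_le_sum hm (hH z hz) (hG z hz) hgz (heq z hz) ht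
  have htr : ∀ x ∈ D, (hess u x).trace = ∑ k, U k x := fun x hx => by
    rw [trace_eq_sum_quad _ b]
    exact sum_congr rfl fun k _ => quad_hess hD hu2 hx _
  have hsq : ContDiffOn ℝ (2 : ℕ) (fun y : EuclideanSpace ℝ (Fin d) => ‖y - x₀‖ ^ 2) D :=
    ((contDiff_id.sub contDiff_const).norm_sq ℝ).contDiffOn
  have hlog : ContDiffOn ℝ (2 : ℕ) (fun y => Real.log (g y)) D :=
    hg.log fun y hy => (hpos y hy).ne'
  have hmax2 : ∀ i, ∑ k, dirDeriv₂ (b i) (U k) z ≤ -(2 * A) := fun i => by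
    have hsumc : ContDiffOn ℝ (2 : ℕ) (fun y => ∑ k, (-1 : ℝ) * U k y) D :=
      ContDiffOn.sum fun k _ => contDiffOn_const.mul (hUc k)
    have := dirDeriv₂_nonneg_of_isMinOn (ξ := b i)
      (f := fun y => ∑ k, (-1 : ℝ) * U k y + (-A) * ‖y - x₀‖ ^ 2) hD
      (hsumc.add (contDiffOn_const.mul hsq)) hz fun y hy => by
        have := hmax y hy
        rw [htr y hy, htr z hz] at this
        simp only [← mul_sum]
        linarith
    rw [dirDeriv₂_add hD hsumc (contDiffOn_const.mul hsq) hz, dirDeriv₂_const_mul hD hsq _ hz,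
      dirDeriv₂_norm_sub_sq, hnorm, dirDeriv₂_sum _ _ hD (fun k _ => hUc k) hz, ← mul_sum] at this
    linarith
  -- `log_P_le` is an equality at `z` by Euler's identity, so the difference of its two sides is
  -- minimal there.
  have hmin2 : ∀ k, (m + 1) * dirDeriv₂ (b k) (fun y => Real.log (g y)) z ≤
      ∑ i, l i * dirDeriv₂ (b k) (U i) z := fun k => by
    have hsumc : ContDiffOn ℝ (2 : ℕ) (fun y => ∑ i, l i * U i y) D :=
      ContDiffOn.sum fun k _ => contDiffOn_const.mul (hUc k)
    have hle : ∀ y ∈ D, (m + 2 : ℝ) + (m + 1) * (Real.log (g y) - Real.log (g z)) ≤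
        ∑ i, l i * U i y := fun y hy => by
      have h := log_P_le (hH z hz) (hH y hy) (hG z hz) (hG y hy)
      rw [heq y hy, heq z hz, ← div_pow, Real.log_pow,
        Real.log_div (hpos y hy).ne' (hpos z hz).ne'] at h
      simp only [quad_hess hD hu2 hy, ← heq z hz] at h
      push_cast at h
      linarith
    have heqz : ∑ i, l i * U i z = m + 2 := by
      have h := sum_mul_eigenvalues_eq (hH z hz) hPpos.ne'
      simp only [← quad_eigenvectorBasis (hH z hz), quad_hess hD hu2 hz] at h
      push_cast at h
      linarith
    have := dirDeriv₂_nonneg_of_isMinOn (ξ := b k)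
      (f := fun y => ∑ i, l i * U i y + (-(m + 1 : ℝ)) * Real.log (g y)) hD
      (hsumc.add (contDiffOn_const.mul hlog)) hz fun y hy => by
        have := hle y hy
        rw [heqz]
        linarith
    rw [dirDeriv₂_add hD hsumc (contDiffOn_const.mul hlog) hz, dirDeriv₂_const_mul hD hlog _ hz,
      dirDeriv₂_sum _ _ hD (fun k _ => hUc k) hz] at this
    linarith
  have h1 : -((d : ℝ) * ((m + 1) * (3 * K / g z))) ≤
      ∑ k, ∑ i, l i * dirDeriv₂ (b k) (U i) z := by
    calc -((d : ℝ) * ((m + 1) * (3 * K / g z)))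
        = ∑ _k : Fin d, (m + 1) * (-(3 * K / g z)) := by simp
      _ ≤ _ := sum_le_sum fun k _ => le_trans (mul_le_mul_of_nonneg_left
          (neg_le_dirDeriv₂_log hD hg hpos hconv hgrad hz (hnorm k)) (by positivity)) (hmin2 k)
  -- Fourth derivatives commute, so for fixed `i` the sum over `k` is the second derivative of the
  -- Laplacian along `b i`.
  have h2 : ∑ k, ∑ i, l i * dirDeriv₂ (b k) (U i) z ≤ -(2 * A) * ∑ i, l i := by
    rw [sum_comm, mul_sum]
    refine sum_le_sum fun i _ => ?_
    rw [← mul_sum, mul_comm]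
    refine mul_le_mul_of_nonneg_right ?_ (hl0 i)
    refine le_trans (le_of_eq (sum_congr rfl fun k _ => ?_)) (hmax2 i)
    exact dirDeriv₂_comm hD hu hz
  have hA0 : 0 < 2 * A := lt_of_le_of_lt (by positivity) hA
  have h3 : 2 * A * (1 / g z) ≤ 2 * A * ∑ i, l i := mul_le_mul_of_nonneg_left hlsum hA0.le
  have h4 : 2 * A * (1 / g z) ≤ (3 * ((d : ℝ) * (m + 1)) * K) * (1 / g z) := by
    have e : (d : ℝ) * ((m + 1) * (3 * K / g z)) = (3 * ((d : ℝ) * (m + 1)) * K) * (1 / g z) := by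
      ring
    linarith
  have h5 : 2 * A ≤ 3 * ((d : ℝ) * (m + 1)) * K := le_of_mul_le_mul_right h4 (by positivity)
  have h6 : (m + 1 : ℝ) ≤ d := by
    have : ((m + 2 : ℕ) : ℝ) ≤ d := by exact_mod_cast hm
    push_cast at this
    linarith
  have h7 : (d : ℝ) * (m + 1) ≤ d ^ 2 := by
    rw [sq]; exact mul_le_mul_of_nonneg_left h6 (by positivity)
  nlinarith

end Hessian

/-! ### Boundary values of the Hessian -/

section Extension

variable {d : ℕ} {D : Set (EuclideanSpace ℝ (Fin d))} {u : EuclideanSpace ℝ (Fin d) → ℝ}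

/-- Existence of the limit makes `extendFrom` the genuine continuous extension rather than an
arbitrary choice. -/
lemma exists_tendsto_hess (hu : ContDiffClosure 2 u D) {x : EuclideanSpace ℝ (Fin d)}
    (hx : x ∈ closure D) : ∃ w, Tendsto (hess u) (𝓝[D] x) (𝓝 w) := by
  obtain ⟨v, hv, hvD⟩ := hu.2.2 2 le_rfl
  let Φ : ContinuousMultilinearMap ℝ (fun _ : Fin 2 => EuclideanSpace ℝ (Fin d)) ℝ →
      Matrix (Fin d) (Fin d) ℝ := fun p => Matrix.of fun i j =>
    p ![EuclideanSpace.single i (1 : ℝ), EuclideanSpace.single j (1 : ℝ)]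
  have hΦ : Continuous Φ := continuous_matrix fun i j =>
    (ContinuousMultilinearMap.apply ℝ (fun _ : Fin 2 => EuclideanSpace ℝ (Fin d)) ℝ
      ![EuclideanSpace.single i (1 : ℝ), EuclideanSpace.single j (1 : ℝ)]).continuous
  have h1 : Tendsto v (𝓝[D] x) (𝓝 (v x)) := (hv x hx).mono_left (nhdsWithin_mono x subset_closure)
  refine ⟨Φ (v x), ((hΦ.tendsto _).comp h1).congr' ?_⟩
  filter_upwards [self_mem_nhdsWithin] with y hy
  simp only [Function.comp_apply, hvD hy]
  rfl

lemma continuousOn_hessExt (hu : ContDiffClosure 2 u D) :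
    ContinuousOn (hessExt D u) (closure D) :=
  continuousOn_extendFrom subset_rfl fun _ hx => exists_tendsto_hess hu hx

lemma hessExt_eq (hD : IsOpen D) (hu : ContDiffClosure 2 u D) {x : EuclideanSpace ℝ (Fin d)}
    (hx : x ∈ D) : hessExt D u x = hess u x := by
  obtain ⟨w, hw⟩ := exists_tendsto_hess hu (subset_closure hx)
  rw [hD.nhdsWithin_eq hx] at hw
  exact extendFrom_eq (subset_closure hx)
    (continuousAt_of_tendsto_nhds hw).continuousWithinAt

end Extension

end HessianEq

/-! ### The global estimate -/

theorem theorem5p1 (d : ℕ) (hd : 2 ≤ d) (K : ℝ) :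
    ∃ N : ℝ≥0, ∀ (m : ℕ), 2 ≤ m → m ≤ d →
      ∀ (D : Set (EuclideanSpace ℝ (Fin d))) (g u : EuclideanSpace ℝ (Fin d) → ℝ),
        IsOpen D → IsConnected D → Bornology.IsBounded D → Metric.diam D ≤ K →
        HessianEq.ContDiffClosure 2 g D →
        (∀ x ∈ D, 0 < g x) →
        HessianEq.ConvexAlongSegments (closure D) (fun x => g x + K * ‖x‖ ^ 2) →
        (∀ x ∈ D, ‖gradient g x‖ ^ 2 ≤ K * g x) →
        ContDiffOn ℝ 4 u D →
        HessianEq.ContDiffClosure 2 u D →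
        (∀ x ∈ D, HessianEq.hess u x ∈ HessianEq.Cone d m) →
        (∀ x ∈ D, HessianEq.P m (HessianEq.hess u x) = g x ^ (m - 1)) →
        (⨆ x ∈ D, ENNReal.ofReal (HessianEq.matNorm (HessianEq.hess u x))) ≤
          N * (1 + ⨆ x ∈ frontier D,
            ENNReal.ofReal (HessianEq.matNorm (HessianEq.hessExt D u x))) := by
  -- For `K ≥ 0` this gives `2A > 3d²K`. Negative `K` is excluded later by `diam D ≤ K`, so
  -- truncation by `toNNReal` is harmless.
  set A : ℝ := 2 * d ^ 2 * K + 1 with hA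
  refine ⟨(d + 1 + A * K ^ 2).toNNReal, ?_⟩
  intro m hm2 hmd D g u hD hconn hbdd hdiam hg hpos hconv hgrad hu hu2 hcone heq
  obtain ⟨k, rfl⟩ := Nat.exists_eq_add_of_le' hm2
  have hK : 0 ≤ K := Metric.diam_nonneg.trans hdiam
  have hA0 : 0 ≤ A := by positivity
  obtain ⟨x₀, hx₀⟩ := hconn.nonempty
  have hdist : ∀ y ∈ closure D, ‖y - x₀‖ ≤ K := fun y hy => by
    rw [← dist_eq_norm]
    refine (Metric.dist_le_diam_of_mem hbdd.closure hy (subset_closure hx₀)).trans ?_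
    rwa [Metric.diam_closure]
  set T := HessianEq.hessExt D u with hT
  have hTD : ∀ x ∈ D, T x = HessianEq.hess u x := fun x hx => HessianEq.hessExt_eq hD hu2 hx
  have hcont : ContinuousOn (fun x => (T x).trace + A * ‖x - x₀‖ ^ 2) (closure D) := by
    refine ContinuousOn.add ?_ (by fun_prop)
    exact (Continuous.matrix_trace continuous_id).comp_continuousOn
      (HessianEq.continuousOn_hessExt hu2)
  obtain ⟨z, hz, hzmax⟩ := hbdd.isCompact_closure.exists_isMaxOn ⟨x₀, subset_closure hx₀⟩ hcont
  have hbound : ∀ x ∈ D, HessianEq.matNorm (HessianEq.hess u x) ≤ (T z).trace + A * K ^ 2 := by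
    intro x hx
    have hH := HessianEq.isHermitian_of_isSymm (HessianEq.isSymm_of_mem_cone (hcone x hx))
    have h1 := HessianEq.matNorm_le_trace hH
      ((HessianEq.isGarding_of_mem_cone hmd (hcone x hx) hH).mono (by omega))
    have h2 : (T x).trace + A * ‖x - x₀‖ ^ 2 ≤ (T z).trace + A * ‖z - x₀‖ ^ 2 :=
      hzmax (subset_closure hx)
    rw [hTD x hx] at h2
    have h3 : A * ‖z - x₀‖ ^ 2 ≤ A * K ^ 2 :=
      mul_le_mul_of_nonneg_left (pow_le_pow_left₀ (norm_nonneg _) (hdist z hz) 2) hA0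
    have h4 : 0 ≤ A * ‖x - x₀‖ ^ 2 := by positivity
    linarith
  have hAK : 0 ≤ A * K ^ 2 := by positivity
  refine iSup₂_le fun x hx => ?_
  by_cases hzD : z ∈ D
  · have ht : (HessianEq.hess u z).trace < 1 := by
      refine HessianEq.trace_hess_lt_one (A := A) (x₀ := x₀) hmd hK ?_ hD hg.1 hpos hconv hgrad hu
        hcone heq hzD fun y hy => ?_
      · have : 0 ≤ (d : ℝ) ^ 2 * K := by positivity
        rw [hA]; linarith
      · have : (T y).trace + A * ‖y - x₀‖ ^ 2 ≤ (T z).trace + A * ‖z - x₀‖ ^ 2 :=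
          hzmax (subset_closure hy)
        rwa [hTD y hy, hTD z hzD] at this
    calc ENNReal.ofReal (HessianEq.matNorm (HessianEq.hess u x))
        ≤ ENNReal.ofReal (d + 1 + A * K ^ 2) := by
          refine ENNReal.ofReal_le_ofReal ((hbound x hx).trans ?_)
          rw [hTD z hzD]
          have : (0 : ℝ) ≤ d := by positivity
          linarith
      _ ≤ _ := le_mul_of_one_le_right' le_self_add
  · have hzf : z ∈ frontier D := by
      rw [frontier, hD.interior_eq]
      exact ⟨hz, hzD⟩
    have hM : 0 ≤ HessianEq.matNorm (T z) := Real.sqrt_nonneg _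
    calc ENNReal.ofReal (HessianEq.matNorm (HessianEq.hess u x))
        ≤ ENNReal.ofReal ((d + 1 + A * K ^ 2) * (1 + HessianEq.matNorm (T z))) := by
          refine ENNReal.ofReal_le_ofReal ((hbound x hx).trans ?_)
          have h1 := HessianEq.trace_le_matNorm (T z)
          have h2 : (0 : ℝ) ≤ d := by positivity
          -- Here `d|T z| + AK² ≤ (d + 1 + AK²)(1 + |T z|)`; the same constant covers the interior
          -- case, where the trace is below 1.
          nlinarith [mul_nonneg hAK hM]
      _ = (d + 1 + A * K ^ 2).toNNReal * (1 + ENNReal.ofReal (HessianEq.matNorm (T z))) := by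
          rw [ENNReal.ofReal_mul (by positivity), ENNReal.ofReal_add zero_le_one hM,
            ENNReal.ofReal_one]
          rfl
      _ ≤ _ := by
          gcongr
          exact le_iSup₂ (f := fun x (_ : x ∈ frontier D) =>
            ENNReal.ofReal (HessianEq.matNorm (T x))) z hzf
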